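/- Consider the memoryless real channel $Y=f(X)+N$, where the noise $N$ is independent of the input $X$ and has probability density $p_N$, with input cost constraint $\mathbb E[\mathcal C(|X|)]\le A$, $A>0$. All asymptotic notations are for $|x|\to\infty$: $g=o(h)$ means that for every $\kappa>0$ there is $c>0$ such that $|g(x)|\le\kappa|h(x)|$ for all $|x|\ge c$, and $h=\omega(g)$ means $g=o(h)$. Put $$p_l(x)=\begin{cases}\inf_{0\le t\le x}p_N(t)&x\ge0\\ \inf_{x\le t\le 0}p_N(t)&x<0,\end{cases}\qquad p_u(x)=\begin{cases}\sup_{t\ge x}p_N(t)&x\ge 0\\ \sup_{t\le x}p_N(t)&x<0.\end{cases}$$ Assume: (C1–C2) $f:\mathbb R\to\mathbb R$ is continuous, $|f(x)|$ is a non-decreasing function of $|x|$, and $|f(x)|\to\infty$ as $|x|\to\infty$. (C3–C4) $\mathcal C:[0,\infty)\to\mathbb R$ is lower semicontinuous and non-decreasing, $\mathcal C(0)=0$, and $\mathcal C(|x|)=\omega(\ln|f(x)|)$. (C5–C6) $p_N$ is positive, continuous and bounded on $\mathbb R$, and there is a non-decreasing function $\mathcal C_N:[0,\infty)\to\mathbb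 R$ with $\mathcal C_N(|x|)=\omega(\ln|x|)$ and $\mathbb E[\mathcal C_N(|N|)]<\infty$. (C7) With $L(x)=\ln[1/p_l(x)]$, there is a constant $\kappa_l>0$ such that $L(x+y)\le\kappa_l(L(x)+L(y))$ whenever $|x|,|y|$ are sufficiently large. (C8) The integral $-\int_{-\infty}^{\infty}p_u(x)\ln p_l(x)\,dx$ exists and is finite. For a probability distribution $F$ on $\mathbb R$ let $p(y;F)=\int p_N(y-f(x))\,dF(x)$ and $$I(F)=\iint p_N(y-f(x))\ln\frac{p_N(y-f(x))}{p(y;F)}\,dy\,dF(x).$$ Call $F$ capacity-achieving if $\int\mathcal C(|x|)\,dF(x)\le A$ and $I(F)=\sup\{I(G):\int\mathcal C(|x|)\,dG(x)\le A\}$. If $\mathcal C(|x|)=o\!\left(\ln\frac1{p_u(f(x))}\right)$, then every capacity-achieving input distribution $F$ has unbounded support, where the support of $F$ is the set of points $x$ with $F((x-\eta,x+\eta))>0$ for all $\eta>0$. -/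

import Mathlib

open MeasureTheory Filter Topology Set Asymptotics
open scoped NNReal ENNReal

noncomputable section

namespace AdditiveChannel

/-- Monotone lower envelope of the noise density `p`:
`inf_{0 ≤ t ≤ x} p t` for `x ≥ 0` and `inf_{x ≤ t ≤ 0} p t` for `x < 0`. -/
def lowerEnv (p : ℝ → ℝ) (x : ℝ) : ℝ :=
  if 0 ≤ x then sInf (p '' Icc 0 x) else sInf (p '' Icc x 0)

/-- Monotone upper envelope of the noise density `p`:
`sup_{t ≥ x} p t` for `x ≥ 0` and `sup_{t ≤ x} p t` for `x < 0`.
(It is used for bounded `p` only.) -/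
def upperEnv (p : ℝ → ℝ) (x : ℝ) : ℝ :=
  if 0 ≤ x then sSup (p '' Ici x) else sSup (p '' Iic x)

/-- Conditions on the input-output function `f`: it is continuous, `|f x|` is a non-decreasing
function of `|x|`, and `|f x| → ∞` as `|x| → ∞`. -/
structure AdmissibleFunction (f : ℝ → ℝ) : Prop where
  continuous : Continuous f
  abs_mono : ∀ x y : ℝ, |x| ≤ |y| → |f x| ≤ |f y|
  tendsto_abs : Tendsto (fun x => |f x|) (cocompact ℝ) atTop

/-- Conditions on the cost function `C : ℝ⁺ → ℝ` (an input `x` costs `C |x|`): it is lower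
semicontinuous and non-decreasing, `C 0 = 0`, and `ln |f x| = o(C |x|)` as `|x| → ∞`. -/
structure AdmissibleCost (f : ℝ → ℝ) (C : ℝ≥0 → ℝ) : Prop where
  lowerSemicontinuous : LowerSemicontinuous C
  monotone : Monotone C
  map_zero : C 0 = 0
  superlog : (fun x : ℝ => Real.log |f x|) =o[cocompact ℝ] (fun x : ℝ => C ‖x‖₊)

/-- Conditions on the noise density `p`. -/
structure AdmissibleNoise (p : ℝ → ℝ) : Prop where
  continuous : Continuous p
  pos : ∀ x, 0 < p x
  bddAbove : BddAbove (range p)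
  /-- `p` is a probability density (integrability follows, as the integral is nonzero). -/
  integral_eq_one : ∫ x, p x = 1
  /-- The noise has a finite super-logarithmic moment. -/
  superlog_moment : ∃ CN : ℝ≥0 → ℝ, Monotone CN ∧
    (fun x : ℝ => Real.log |x|) =o[cocompact ℝ] (fun x : ℝ => CN ‖x‖₊) ∧
    Integrable (fun x : ℝ => CN ‖x‖₊ * p x)
  /-- `L = ln (1 / lowerEnv p)` satisfies `L (x + y) ≤ κ (L x + L y)` for large `|x|`, `|y|`. -/
  quasi_subadditive : ∃ κ > (0 : ℝ), ∃ R : ℝ, ∀ x y : ℝ, R ≤ |x| → R ≤ |y| →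
    Real.log (1 / lowerEnv p (x + y)) ≤
      κ * (Real.log (1 / lowerEnv p x) + Real.log (1 / lowerEnv p y))
  /-- The integral of `- upperEnv p * ln (lowerEnv p)` exists and is finite. -/
  integrable_env : Integrable (fun x : ℝ => -(upperEnv p x * Real.log (lowerEnv p x)))

/-- Density `p(y; F) = ∫ p (y - f x) dF(x)` of the output `Y = f(X) + N` for `X ∼ F`. -/
def outputDensity (f p : ℝ → ℝ) (F : ProbabilityMeasure ℝ) (y : ℝ) : ℝ :=
  ∫ x, p (y - f x) ∂(F : Measure ℝ)

/-- The integrand `p (y - f x) ln [p (y - f x) / p(y; F)]` of the mutual information. -/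
def infoIntegrand (f p : ℝ → ℝ) (F : ProbabilityMeasure ℝ) (x y : ℝ) : ℝ :=
  p (y - f x) * Real.log (p (y - f x) / outputDensity f p F y)

/-- Mutual information `I(F) = ∬ p (y - f x) ln [p (y - f x) / p(y; F)] dy dF(x)` between the
input `X ∼ F` and the output `Y = f(X) + N`, as a Lebesgue integral with values in the extended
reals: the integral of the positive part minus the integral of the negative part.  (The latter is
always finite, because `p ln (q / p) ≤ q`.) -/
def mutualInfo (f p : ℝ → ℝ) (F : ProbabilityMeasure ℝ) : EReal :=
  ((∫⁻ x, ∫⁻ y, ENNReal.ofReal (infoIntegrand f p F x y) ∂volume ∂(F : Measure ℝ) : ℝ≥0∞) : EReal)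
  - ((∫⁻ x, ∫⁻ y, ENNReal.ofReal (-infoIntegrand f p F x y) ∂volume ∂(F : Measure ℝ) : ℝ≥0∞) :
      EReal)

/-- The set of input distributions `F` with average cost `∫ C |x| dF(x) ≤ A`. -/
def inputSet (C : ℝ≥0 → ℝ) (A : ℝ) : Set (ProbabilityMeasure ℝ) :=
  {F | Integrable (fun x : ℝ => C ‖x‖₊) (F : Measure ℝ) ∧ ∫ x, C ‖x‖₊ ∂(F : Measure ℝ) ≤ A}

/-- Channel capacity: the supremum of the mutual information under the cost constraint. -/
def capacity (f p : ℝ → ℝ) (C : ℝ≥0 → ℝ) (A : ℝ) : EReal :=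
  ⨆ F ∈ inputSet C A, mutualInfo f p F

/-- `F` satisfies the cost constraint and attains the capacity. -/
def IsCapacityAchieving (f p : ℝ → ℝ) (C : ℝ≥0 → ℝ) (A : ℝ) (F : ProbabilityMeasure ℝ) : Prop :=
  F ∈ inputSet C A ∧ mutualInfo f p F = capacity f p C A

end AdditiveChannel

end

/-!
# Capacity-achieving inputs of an additive channel have unbounded support

Suppose that the support of a capacity-achieving `F` is bounded, so that `|f X| ≤ B` almost surely.
Instead of deriving and contradicting the Kuhn-Tucker conditions, the proof exhibits an explicit
better input. For a far away point `x` let `t = p_u(f x)`, `l = ln (1 / t)` and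
`s = t C(|x|) / A`, and mix
`G = (1 - t - s) F + s δ₀ + t δₓ`.
As `C 0 = 0`, the weight `s` at the origin pays for the costly input `x`, and `G` meets the cost
constraint (`integrable_mixture`, `integral_mixture`).

For inputs with bounded `f X`, the mutual information is `h(Y) - h(N)` with finite entropies
(`mutualInfo_eq_entropy_sub`): the super-logarithmic moment of the noise gives `Y` a finite
logarithmic moment, and a bounded density with such a moment has finite entropy
(`integrable_mul_log`).

In `h(p_G) = ∫ p_G (-ln p_G)`, the components `F` and `δ₀` contribute at least their own entropies,
by Gibbs' inequality. The component `δₓ` puts mass at least `c` on a half-line beyond `f x`, where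
the other components have density at most `t` (`AdmissibleNoise.exists_halfLine`). There
`p_G ≤ (1 + M) t`, where `M` bounds `p`, so `δₓ` contributes at least `t (c l - ln (1 + M))`
(`entropy_mixture_ge`). Altogether
`I(G) - I(F) ≥ t (c l - ln (1 + M) - h(N) - (1 + C(|x|) / A) I(F))`,
and this is positive for large `|x|`, since `l → ∞` (`tendsto_log_one_div_upperEnv`) and
`C(|x|) = o(l)`. Taking `t` as small as `p_u(f x)` makes this finite increment do the work of a
derivative of `I` at `F`.
-/

namespace AdditiveChannel

variable {f p : ℝ → ℝ}

/-! ### Entropy integrals -/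

/-- Pointwise Gibbs inequality. -/
theorem mul_neg_log_ge {a b : ℝ} (ha : 0 ≤ a) (hb : 0 < b) :
    -(a * Real.log a) + (a - b) ≤ a * -Real.log b := by
  rcases ha.eq_or_lt with rfl | ha
  · simpa using hb.le
  · have h := mul_le_mul_of_nonneg_left (Real.log_le_sub_one_of_pos (div_pos hb ha)) ha.le
    rw [Real.log_div hb.ne' ha.ne'] at h
    have h2 : a * (b / a - 1) = b - a := by field_simp
    rw [h2] at h
    linarith

/-- A bounded integrable function with a finite logarithmic moment has a finite entropy: Gibbs'
inequality against the (unnormalised) Cauchy density `(1 + y ^ 2)⁻¹` bounds `-(u * log u)` from above. -/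
theorem integrable_mul_log {u : ℝ → ℝ} {M : ℝ} (hu : Measurable u) (h0 : ∀ y, 0 ≤ u y)
    (hM : ∀ y, u y ≤ M) (hui : Integrable u)
    (hlog : Integrable fun y => u y * Real.log (1 + y ^ 2)) :
    Integrable fun y => u y * Real.log (u y) := by
  have hup : Integrable fun y => u y * Real.log M := hui.mul_const _
  have hlow : Integrable fun y : ℝ => -(u y * Real.log (1 + y ^ 2) + (1 + y ^ 2)⁻¹) :=
    (hlog.add integrable_inv_one_add_sq).neg
  refine integrable_of_le_of_le (hu.mul hu.log).aestronglyMeasurable (ae_of_all _ fun y => ?_)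
    (ae_of_all _ fun y => ?_) hlow hup
  · have h := mul_neg_log_ge (h0 y) (b := (1 + y ^ 2)⁻¹) (by positivity)
    rw [Real.log_inv, neg_neg] at h
    have := h0 y
    dsimp only
    linarith
  · rcases (h0 y).eq_or_lt with h | h
    · simp [← h]
    · exact mul_le_mul_of_nonneg_left (Real.log_le_log h (hM y)) h.le

theorem log_one_add_sq_add_le (a b : ℝ) :
    Real.log (1 + (a + b) ^ 2) ≤
      Real.log 2 + Real.log (1 + a ^ 2) + Real.log (1 + b ^ 2) := by
  rw [← Real.log_mul (by norm_num) (by positivity), ← Real.log_mul (by positivity) (by positivity)]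
  refine Real.log_le_log (by positivity) ?_
  nlinarith [sq_nonneg (a - b), sq_nonneg (a * b)]

theorem log_one_add_sq_nonneg (y : ℝ) : 0 ≤ Real.log (1 + y ^ 2) :=
  Real.log_nonneg (by nlinarith [sq_nonneg y])

/-! ### The noise density -/

namespace AdmissibleNoise

theorem integrable (hp : AdmissibleNoise p) : Integrable p := by
  by_contra h
  have := hp.integral_eq_one
  rw [integral_undef h] at this
  exact zero_ne_one this

theorem exists_bound (hp : AdmissibleNoise p) : ∃ M, 0 < M ∧ ∀ x, p x ≤ M := by
  obtain ⟨M, hM⟩ := hp.bddAbove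
  exact ⟨M, (hp.pos 0).trans_le (hM ⟨0, rfl⟩), fun x => hM ⟨x, rfl⟩⟩

/-- The noise has a finite logarithmic moment. -/
theorem integrable_mul_log_one_add_sq (hp : AdmissibleNoise p) :
    Integrable fun x => p x * Real.log (1 + x ^ 2) := by
  obtain ⟨CN, -, hlo, hint⟩ := hp.superlog_moment
  have hcont : Continuous fun x => p x * Real.log (1 + x ^ 2) :=
    hp.continuous.mul (Continuous.log (by fun_prop) fun x => by positivity)
  -- `1 + x ^ 2 ≤ |x| ^ 3` for `|x| ≥ 2`.
  have h1 : (fun x : ℝ => Real.log (1 + x ^ 2)) =O[cocompact ℝ] fun x : ℝ => Real.log |x| := by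
    refine IsBigO.of_bound 3 ?_
    have : ∀ᶠ x : ℝ in cocompact ℝ, 2 ≤ ‖x‖ :=
      (tendsto_norm_cocompact_atTop (E := ℝ)).eventually_ge_atTop 2
    filter_upwards [this] with x hx
    rw [Real.norm_eq_abs] at hx
    rw [Real.norm_of_nonneg (log_one_add_sq_nonneg x),
      Real.norm_of_nonneg (Real.log_nonneg (by linarith))]
    have : (3 : ℝ) * Real.log |x| = Real.log (|x| ^ 3) := by rw [Real.log_pow]; norm_num
    rw [this, ← sq_abs]
    refine Real.log_le_log (by positivity) ?_
    nlinarith [mul_le_mul_of_nonneg_left hx (sq_nonneg |x|)]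
  have h2 := (isBigO_refl p (cocompact ℝ)).mul (h1.trans hlo.isBigO)
  refine hcont.locallyIntegrable.integrable_of_isBigO_cocompact
    (g := fun x => CN ‖x‖₊ * p x) ?_ (hint.integrableAtFilter _)
  simpa only [mul_comm] using h2

theorem integrable_mul_log (hp : AdmissibleNoise p) :
    Integrable fun x => p x * Real.log (p x) := by
  obtain ⟨M, -, hM⟩ := hp.exists_bound
  exact AdditiveChannel.integrable_mul_log hp.continuous.measurable (fun x => (hp.pos x).le) hM
    hp.integrable hp.integrable_mul_log_one_add_sq

theorem upperEnv_pos (hp : AdmissibleNoise p) (x : ℝ) : 0 < upperEnv p x := by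
  unfold upperEnv
  split_ifs
  · exact (hp.pos x).trans_le
      (le_csSup (hp.bddAbove.mono (image_subset_range _ _)) ⟨x, self_mem_Ici, rfl⟩)
  · exact (hp.pos x).trans_le
      (le_csSup (hp.bddAbove.mono (image_subset_range _ _)) ⟨x, self_mem_Iic, rfl⟩)

/-- For every `B` and every shift `z` there is a half-line of outputs `y` that stays beyond the
upper envelope at `z` for all inputs of size at most `B`, and to which the noise density centred
at `z` gives a mass that is bounded below independently of `z`. -/
theorem exists_halfLine (hp : AdmissibleNoise p) (B : ℝ) :
    ∃ c > 0, ∀ z, ∃ S : Set ℝ, MeasurableSet S ∧ c ≤ ∫ y in S, p (y - z) ∧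
      ∀ y ∈ S, ∀ b, |b| ≤ B → p (y - b) ≤ upperEnv p z := by
  have hpos : ∀ S : Set ℝ, 0 < volume S → 0 < ∫ y in S, p y := fun S hS => by
    rw [setIntegral_pos_iff_support_of_nonneg_ae (ae_of_all _ fun x => (hp.pos x).le)
      hp.integrable.integrableOn]
    have : Function.support p = univ := by ext x; simpa using (hp.pos x).ne'
    simpa [this] using hS
  have h1 := hpos (Ici B) (by simp)
  have h2 := hpos (Iic (-B)) (by simp)
  have hshift : ∀ (S : Set ℝ) (z : ℝ), MeasurableSet S →
      ∫ y in (fun y => y - z) ⁻¹' S, p (y - z) = ∫ y in S, p y := fun S z hS =>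
    (measurePreserving_sub_right volume z).setIntegral_preimage_emb
      (MeasurableEquiv.subRight z).measurableEmbedding p S
  refine ⟨min (∫ y in Ici B, p y) (∫ y in Iic (-B), p y), lt_min h1 h2, fun z => ?_⟩
  have hbdd : ∀ S : Set ℝ, BddAbove (p '' S) := fun S => hp.bddAbove.mono (image_subset_range _ _)
  by_cases hz : 0 ≤ z
  · refine ⟨(fun y => y - z) ⁻¹' Ici B, measurableSet_Ici.preimage (by fun_prop), ?_, ?_⟩
    · rw [hshift _ _ measurableSet_Ici]; exact min_le_left _ _
    · intro y hy b hb
      rw [upperEnv, if_pos hz]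
      refine le_csSup (hbdd _) ⟨_, ?_, rfl⟩
      have := (abs_le.1 hb).2
      simp only [mem_preimage, mem_Ici] at hy ⊢
      linarith
  · refine ⟨(fun y => y - z) ⁻¹' Iic (-B), measurableSet_Iic.preimage (by fun_prop), ?_, ?_⟩
    · rw [hshift _ _ measurableSet_Iic]; exact min_le_right _ _
    · intro y hy b hb
      rw [upperEnv, if_neg hz]
      refine le_csSup (hbdd _) ⟨_, ?_, rfl⟩
      have := (abs_le.1 hb).1
      simp only [mem_preimage, mem_Iic] at hy ⊢
      linarith

end AdmissibleNoise

/-! ### Output densities and mutual information for bounded channel inputs -/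

/-- The differential entropy `-∫ u ln u` of a density `u`. -/
noncomputable def entropy (u : ℝ → ℝ) : ℝ := -∫ y, u y * Real.log (u y)

section Output

variable (hf : AdmissibleFunction f) (hp : AdmissibleNoise p) (G : ProbabilityMeasure ℝ)
include hf hp

theorem integrable_kernel (μ : Measure ℝ) [IsFiniteMeasure μ] (y : ℝ) :
    Integrable (fun x => p (y - f x)) μ := by
  obtain ⟨M, -, hM⟩ := hp.exists_bound
  refine Integrable.of_bound (C := M) ?_ (ae_of_all _ fun x => ?_)
  · have := hp.continuous; have := hf.continuous
    exact Continuous.aestronglyMeasurable (by fun_prop)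
  · rw [Real.norm_of_nonneg (hp.pos _).le]; exact hM _

theorem outputDensity_pos (y : ℝ) : 0 < outputDensity f p G y := by
  unfold outputDensity
  rw [integral_pos_iff_support_of_nonneg (fun x => (hp.pos _).le) (integrable_kernel hf hp _ y)]
  have : Function.support (fun x => p (y - f x)) = univ := by
    ext x; simpa using (hp.pos (y - f x)).ne'
  rw [this]; simp

theorem outputDensity_le {y M : ℝ} (h : ∀ᵐ x ∂(G : Measure ℝ), p (y - f x) ≤ M) :
    outputDensity f p G y ≤ M := by
  have := integral_mono_ae (integrable_kernel hf hp (G : Measure ℝ) y) (integrable_const M) h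
  simpa [outputDensity] using this

theorem measurable_outputDensity : Measurable (outputDensity f p G) := by
  have h1 := hp.continuous; have h2 := hf.continuous
  have : Continuous (Function.uncurry fun y x => p (y - f x)) := by
    unfold Function.uncurry; fun_prop
  exact (this.stronglyMeasurable.integral_prod_right (ν := (G : Measure ℝ))).measurable

omit hp in
theorem integrable_prod_comp_sub {φ : ℝ → ℝ} (hφ : Integrable φ) (hφm : Measurable φ) :
    Integrable (fun z : ℝ × ℝ => φ (z.2 - f z.1)) ((G : Measure ℝ).prod volume) := by
  have h2 := hf.continuous.measurable
  have hm : Measurable fun z : ℝ × ℝ => φ (z.2 - f z.1) := by fun_prop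
  rw [integrable_prod_iff hm.aestronglyMeasurable]
  refine ⟨ae_of_all _ fun x => hφ.comp_sub_right (f x), ?_⟩
  have : ∀ x, ∫ y, ‖φ (y - f x)‖ = ∫ y, ‖φ y‖ := fun x =>
    integral_sub_right_eq_self (fun y => ‖φ y‖) (f x)
  simp only [this]
  exact integrable_const _

theorem integrable_outputDensity : Integrable (outputDensity f p G) :=
  (integrable_prod_comp_sub hf G hp.integrable hp.continuous.measurable).integral_prod_right

theorem integral_outputDensity : ∫ y, outputDensity f p G y = 1 := by
  have h := integral_integral_swap (f := fun x y => p (y - f x))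
    (integrable_prod_comp_sub hf G hp.integrable hp.continuous.measurable)
  unfold outputDensity
  rw [← h]
  have : ∀ x, ∫ y, p (y - f x) = 1 := fun x =>
    (integral_sub_right_eq_self p (f x)).trans hp.integral_eq_one
  simp [this]

variable {B : ℝ} (hB : ∀ᵐ x ∂(G : Measure ℝ), |f x| ≤ B)
include hB

theorem integrable_outputDensity_mul_log_one_add_sq :
    Integrable fun y => outputDensity f p G y * Real.log (1 + y ^ 2) := by
  have hm := hp.continuous.measurable
  have h2 := hf.continuous.measurable
  have hφ : Integrable fun n =>
      p n * (Real.log 2 + Real.log (1 + n ^ 2) + Real.log (1 + B ^ 2)) := by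
    have := ((hp.integrable.mul_const (Real.log 2)).add hp.integrable_mul_log_one_add_sq).add
      (hp.integrable.mul_const (Real.log (1 + B ^ 2)))
    refine this.congr (ae_of_all _ fun n => ?_)
    simp only [Pi.add_apply]; ring
  have hprod := integrable_prod_comp_sub hf G hφ (by fun_prop)
  have : Integrable (fun z : ℝ × ℝ => p (z.2 - f z.1) * Real.log (1 + z.2 ^ 2))
      ((G : Measure ℝ).prod volume) := by
    refine hprod.mono' (by fun_prop) ?_
    filter_upwards [Measure.quasiMeasurePreserving_fst.ae hB] with z hz
    rw [Real.norm_of_nonneg (mul_nonneg (hp.pos _).le (log_one_add_sq_nonneg _))]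
    refine mul_le_mul_of_nonneg_left ?_ (hp.pos _).le
    have h := log_one_add_sq_add_le (z.2 - f z.1) (f z.1)
    rw [sub_add_cancel] at h
    refine h.trans ?_
    have : f z.1 ^ 2 ≤ B ^ 2 := sq_le_sq' (abs_le.1 hz).1 (abs_le.1 hz).2
    gcongr
  refine this.integral_prod_right.congr (ae_of_all _ fun y => ?_)
  simp only [integral_mul_const, outputDensity]

theorem integrable_outputDensity_mul_log :
    Integrable fun y => outputDensity f p G y * Real.log (outputDensity f p G y) := by
  obtain ⟨M, -, hM⟩ := hp.exists_bound
  exact integrable_mul_log (measurable_outputDensity hf hp G)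
    (fun y => (outputDensity_pos hf hp G y).le)
    (fun y => outputDensity_le hf hp G (ae_of_all _ fun x => hM _))
    (integrable_outputDensity hf hp G)
    (integrable_outputDensity_mul_log_one_add_sq hf hp G hB)

/-- If `f X` is bounded, then `I(X; Y) = h(Y) - h(N)`, where both entropies are finite. -/
theorem mutualInfo_eq_entropy_sub :
    mutualInfo f p G = ((entropy (outputDensity f p G) - entropy p : ℝ) : EReal) := by
  have hm := hp.continuous.measurable
  have h2 := hf.continuous.measurable
  have hq := measurable_outputDensity hf hp G
  have hsplit : ∀ x y, infoIntegrand f p G x y = p (y - f x) * Real.log (p (y - f x)) -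
      p (y - f x) * Real.log (outputDensity f p G y) := fun x y => by
    rw [infoIntegrand, Real.log_div (hp.pos _).ne' (outputDensity_pos hf hp G y).ne', mul_sub]
  have i1 : Integrable (fun z : ℝ × ℝ => p (z.2 - f z.1) * Real.log (p (z.2 - f z.1)))
      ((G : Measure ℝ).prod volume) :=
    integrable_prod_comp_sub hf G (φ := fun n => p n * Real.log (p n)) hp.integrable_mul_log
      (by fun_prop)
  have i2 : Integrable (fun z : ℝ × ℝ => p (z.2 - f z.1) * Real.log (outputDensity f p G z.2))
      ((G : Measure ℝ).prod volume) := by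
    rw [integrable_prod_iff' (by fun_prop)]
    refine ⟨ae_of_all _ fun y =>
      (integrable_kernel hf hp (G : Measure ℝ) y).mul_const (Real.log (outputDensity f p G y)), ?_⟩
    refine (integrable_outputDensity_mul_log hf hp G hB).norm.congr (ae_of_all _ fun y => ?_)
    simp only [norm_mul, integral_mul_const]
    rw [Real.norm_of_nonneg (outputDensity_pos hf hp G y).le]
    simp only [Real.norm_of_nonneg (hp.pos _).le, outputDensity]
  have i3 : Integrable (fun z : ℝ × ℝ => infoIntegrand f p G z.1 z.2)
      ((G : Measure ℝ).prod volume) := by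
    simp only [hsplit]
    exact i1.sub i2
  have e1 : ∫ z, infoIntegrand f p G z.1 z.2 ∂((G : Measure ℝ).prod volume) =
      entropy (outputDensity f p G) - entropy p := by
    simp only [hsplit]
    rw [integral_sub i1 i2, integral_prod _ i1, integral_prod_symm _ i2]
    have (x : ℝ) : ∫ y, p (y - f x) * Real.log (p (y - f x)) = ∫ n, p n * Real.log (p n) :=
      integral_sub_right_eq_self (fun n => p n * Real.log (p n)) (f x)
    simp only [this, integral_mul_const, entropy]
    simp only [outputDensity, integral_const, probReal_univ, one_smul]
    ring
  have l1 : ∫⁻ x, ∫⁻ y, ENNReal.ofReal (infoIntegrand f p G x y) ∂volume ∂(G : Measure ℝ) =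
      ∫⁻ z, ENNReal.ofReal (infoIntegrand f p G z.1 z.2) ∂((G : Measure ℝ).prod volume) :=
    (lintegral_prod (fun z : ℝ × ℝ => ENNReal.ofReal (infoIntegrand f p G z.1 z.2))
      i3.aemeasurable.ennreal_ofReal).symm
  have l2 : ∫⁻ x, ∫⁻ y, ENNReal.ofReal (-infoIntegrand f p G x y) ∂volume ∂(G : Measure ℝ) =
      ∫⁻ z, ENNReal.ofReal (-infoIntegrand f p G z.1 z.2) ∂((G : Measure ℝ).prod volume) :=
    (lintegral_prod (fun z : ℝ × ℝ => ENNReal.ofReal (-infoIntegrand f p G z.1 z.2))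
      i3.aemeasurable.neg.ennreal_ofReal).symm
  have t1 := i3.lintegral_lt_top
  have t2 := i3.neg.lintegral_lt_top
  simp only [Pi.neg_apply] at t2
  rw [← e1, integral_eq_lintegral_pos_part_sub_lintegral_neg_part i3, mutualInfo, l1, l2,
    EReal.coe_sub, EReal.coe_ennreal_toReal t1.ne, EReal.coe_ennreal_toReal t2.ne]

end Output

/-! ### The competing input distribution -/

/-- The mixture `(1 - t - s) F + s δ₀ + t δₓ`. -/
noncomputable def mixture (F : ProbabilityMeasure ℝ) (s t x : ℝ) (hs : 0 ≤ s) (ht : 0 ≤ t)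
    (hst : t + s ≤ 1) : ProbabilityMeasure ℝ :=
  ⟨ENNReal.ofReal (1 - t - s) • (F : Measure ℝ) + ENNReal.ofReal s • Measure.dirac 0 +
    ENNReal.ofReal t • Measure.dirac x, ⟨by
      simp only [Measure.coe_add, Measure.coe_smul, Pi.add_apply, Pi.smul_apply, measure_univ,
        smul_eq_mul, mul_one]
      rw [← ENNReal.ofReal_add (by linarith) hs, ← ENNReal.ofReal_add (by linarith) ht,
        ← ENNReal.ofReal_one]
      congr 1; ring⟩⟩

section Mixture

variable (F : ProbabilityMeasure ℝ) {s t x : ℝ} (hs : 0 ≤ s) (ht : 0 ≤ t) (hst : t + s ≤ 1)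

theorem integrable_mixture {φ : ℝ → ℝ} (hφ : Integrable φ (F : Measure ℝ)) :
    Integrable φ (mixture F s t x hs ht hst : Measure ℝ) :=
  ((hφ.smul_measure ENNReal.ofReal_ne_top).add_measure
    ((integrable_dirac (by simp)).smul_measure ENNReal.ofReal_ne_top)).add_measure
    ((integrable_dirac (by simp)).smul_measure ENNReal.ofReal_ne_top)

theorem integral_mixture {φ : ℝ → ℝ} (hφ : Integrable φ (F : Measure ℝ)) :
    ∫ z, φ z ∂(mixture F s t x hs ht hst : Measure ℝ) =
      (1 - t - s) * ∫ z, φ z ∂(F : Measure ℝ) + s * φ 0 + t * φ x := by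
  have h1 := hφ.smul_measure (c := ENNReal.ofReal (1 - t - s)) ENNReal.ofReal_ne_top
  have h2 (z c : ℝ) : Integrable φ (ENNReal.ofReal c • Measure.dirac z) :=
    (integrable_dirac (by simp)).smul_measure ENNReal.ofReal_ne_top
  rw [mixture, ProbabilityMeasure.coe_mk, integral_add_measure (h1.add_measure (h2 0 s)) (h2 x t),
    integral_add_measure h1 (h2 0 s), integral_smul_measure, integral_smul_measure,
    integral_smul_measure, integral_dirac, integral_dirac, ENNReal.toReal_ofReal (by linarith),
    ENNReal.toReal_ofReal hs, ENNReal.toReal_ofReal ht]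
  rfl

theorem ae_mixture {P : ℝ → Prop} (hF : ∀ᵐ z ∂(F : Measure ℝ), P z) (h0 : P 0) (hx : P x) :
    ∀ᵐ z ∂(mixture F s t x hs ht hst : Measure ℝ), P z := by
  rw [mixture, ProbabilityMeasure.coe_mk, ae_add_measure_iff, ae_add_measure_iff]
  exact ⟨⟨Measure.ae_smul_measure hF _,
    Measure.ae_smul_measure (by simpa [ae_dirac_eq] using h0) _⟩,
    Measure.ae_smul_measure (by simpa [ae_dirac_eq] using hx) _⟩

variable (hf : AdmissibleFunction f) (hp : AdmissibleNoise p)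
include hf hp

theorem outputDensity_mixture (y : ℝ) :
    outputDensity f p (mixture F s t x hs ht hst) y =
      (1 - t - s) * outputDensity f p F y + s * p (y - f 0) + t * p (y - f x) :=
  integral_mixture F hs ht hst (integrable_kernel hf hp (F : Measure ℝ) y)

/-- Entropy gain of the mixture. The components `F` and `δ₀` contribute at least their own
entropies, by Gibbs' inequality. The component `δₓ` contributes the mean under `p (· - f x)` of
`-log` of the mixture density, which is at least `-log M` everywhere and `l - log M` on `S`. -/
theorem entropy_mixture_ge {B M l c : ℝ} {S : Set ℝ}
    (hB : ∀ᵐ z ∂(F : Measure ℝ), |f z| ≤ B) (hS : MeasurableSet S)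
    (hM : ∀ y, outputDensity f p (mixture F s t x hs ht hst) y ≤ M)
    (hMS : ∀ y ∈ S, outputDensity f p (mixture F s t x hs ht hst) y ≤ M * Real.exp (-l))
    (hl : 0 ≤ l) (hc : c ≤ ∫ y in S, p (y - f x)) :
    (1 - t - s) * entropy (outputDensity f p F) + s * entropy p + t * (c * l - Real.log M) ≤
      entropy (outputDensity f p (mixture F s t x hs ht hst)) := by
  set G := mixture F s t x hs ht hst with hG
  have hGB : ∀ᵐ z ∂(G : Measure ℝ), |f z| ≤ max B |f x| :=
    ae_mixture F hs ht hst (hB.mono fun z hz => hz.trans (le_max_left _ _))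
      ((hf.abs_mono 0 x (by simp)).trans (le_max_right _ _)) (le_max_right _ _)
  have hGpos := outputDensity_pos hf hp G
  have hMpos : 0 < M := (hGpos 0).trans_le (hM 0)
  -- Integrating the pointwise bounds avoids the integrability of the cross terms, such as
  -- `p_F * log p_G`.
  have iG := (integrable_outputDensity_mul_log hf hp G hGB).neg
  have iF := (integrable_outputDensity_mul_log hf hp F hB).neg
  have iG' := integrable_outputDensity hf hp G
  have iF' := integrable_outputDensity hf hp F
  have i0 : Integrable fun y => -(p (y - f 0) * Real.log (p (y - f 0))) :=
    (hp.integrable_mul_log.comp_sub_right (f 0)).neg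
  have i0' := hp.integrable.comp_sub_right (f 0)
  have ix' := hp.integrable.comp_sub_right (f x)
  have hpt : ∀ y, (1 - t - s) * (-(outputDensity f p F y * Real.log (outputDensity f p F y)) +
        (outputDensity f p F y - outputDensity f p G y)) +
      s * (-(p (y - f 0) * Real.log (p (y - f 0))) + (p (y - f 0) - outputDensity f p G y)) +
      t * (l * S.indicator (fun y => p (y - f x)) y - Real.log M * p (y - f x)) ≤
      -(outputDensity f p G y * Real.log (outputDensity f p G y)) := by
    intro y
    have g1 := mul_le_mul_of_nonneg_left
      (mul_neg_log_ge (outputDensity_pos hf hp F y).le (hGpos y)) (show 0 ≤ 1 - t - s by linarith)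
    have g2 := mul_le_mul_of_nonneg_left (mul_neg_log_ge (hp.pos (y - f 0)).le (hGpos y)) hs
    have g3 : l * S.indicator (fun y => p (y - f x)) y - Real.log M * p (y - f x) ≤
        p (y - f x) * -Real.log (outputDensity f p G y) := by
      by_cases hy : y ∈ S
      · rw [indicator_of_mem hy]
        have := Real.log_le_log (hGpos y) (hMS y hy)
        rw [Real.log_mul hMpos.ne' (Real.exp_ne_zero _), Real.log_exp] at this
        nlinarith [hp.pos (y - f x)]
      · rw [indicator_of_notMem hy]
        have := Real.log_le_log (hGpos y) (hM y)
        nlinarith [hp.pos (y - f x)]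
    have g3 := mul_le_mul_of_nonneg_left g3 ht
    have e : -(outputDensity f p G y * Real.log (outputDensity f p G y)) =
        (1 - t - s) * (outputDensity f p F y * -Real.log (outputDensity f p G y)) +
        s * (p (y - f 0) * -Real.log (outputDensity f p G y)) +
        t * (p (y - f x) * -Real.log (outputDensity f p G y)) := by
      linear_combination
        -Real.log (outputDensity f p G y) * outputDensity_mixture F (x := x) hs ht hst hf hp y
    linarith
  have j1 := (iF.add (iF'.sub iG')).const_mul (1 - t - s)
  have j2 := (i0.add (i0'.sub iG')).const_mul s
  have j3 := (((ix'.indicator hS).const_mul l).sub (ix'.const_mul (Real.log M))).const_mul t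
  have key := integral_mono ((j1.add j2).add j3) iG hpt
  have e1 : ∫ y, p (y - f x) = 1 :=
    (integral_sub_right_eq_self p (f x)).trans hp.integral_eq_one
  have e0 : ∫ y, p (y - f 0) = 1 :=
    (integral_sub_right_eq_self p (f 0)).trans hp.integral_eq_one
  have e0' : ∫ y, p (y - f 0) * Real.log (p (y - f 0)) = ∫ n, p n * Real.log (p n) :=
    integral_sub_right_eq_self (fun n => p n * Real.log (p n)) (f 0)
  rw [integral_add' (j1.add j2) j3, integral_add' j1 j2, integral_const_mul, integral_const_mul,
    integral_const_mul, integral_add' iF (iF'.sub iG'), integral_sub' iF' iG',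
    integral_add' i0 (i0'.sub iG'), integral_sub' i0' iG',
    integral_sub' ((ix'.indicator hS).const_mul l) (ix'.const_mul (Real.log M)),
    integral_const_mul, integral_const_mul, integral_indicator hS,
    integral_outputDensity hf hp F, integral_outputDensity hf hp G, e1, e0,
    integral_neg', integral_neg', integral_neg, e0'] at key
  unfold entropy
  have := mul_le_mul_of_nonneg_left (mul_le_mul_of_nonneg_left hc hl) ht
  linarith

end Mixture

/-! ### Growth of the code length -/

/-- `ln |f x| = o(C |x|) = o(ln (1 / p_u(f x)))` forces `|ln (1 / p_u(f x))|` to infinity, and the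
sign is eventually positive because `p_u` is bounded. -/
theorem tendsto_log_one_div_upperEnv {C : ℝ≥0 → ℝ} (hf : AdmissibleFunction f)
    (hp : AdmissibleNoise p) (hC : AdmissibleCost f C)
    (hcost : (fun x : ℝ => C ‖x‖₊) =o[cocompact ℝ]
      (fun x : ℝ => Real.log (1 / upperEnv p (f x)))) :
    Tendsto (fun x : ℝ => Real.log (1 / upperEnv p (f x))) (cocompact ℝ) atTop := by
  obtain ⟨M, -, hM⟩ := hp.exists_bound
  have habs : Tendsto (fun x : ℝ => |Real.log (1 / upperEnv p (f x))|) (cocompact ℝ) atTop := by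
    refine tendsto_atTop_mono' _ ?_ (Real.tendsto_log_atTop.comp hf.tendsto_abs)
    filter_upwards [(hC.superlog.trans hcost).bound one_pos] with x hx
    rw [one_mul] at hx
    exact (le_abs_self _).trans hx
  refine habs.congr' ?_
  filter_upwards [habs.eventually_gt_atTop (Real.log M)] with x hx
  have hle : upperEnv p (f x) ≤ M := by
    unfold upperEnv
    split_ifs
    · exact csSup_le (nonempty_Ici.image _) (by rintro _ ⟨z, -, rfl⟩; exact hM z)
    · exact csSup_le (nonempty_Iic.image _) (by rintro _ ⟨z, -, rfl⟩; exact hM z)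
  have := Real.log_le_log (hp.upperEnv_pos (f x)) hle
  rw [one_div, Real.log_inv] at hx ⊢
  rcases abs_choice (-Real.log (upperEnv p (f x))) with h | h
  · exact h
  · rw [h] at hx; linarith

end AdditiveChannel

open AdditiveChannel in
theorem theorem2 (f p : ℝ → ℝ) (C : ℝ≥0 → ℝ) (A : ℝ)
    (hf : AdditiveChannel.AdmissibleFunction f)
    (hC : AdditiveChannel.AdmissibleCost f C)
    (hp : AdditiveChannel.AdmissibleNoise p)
    (hA : 0 < A)
    (hcost : (fun x : ℝ => C ‖x‖₊) =o[cocompact ℝ]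
      (fun x : ℝ => Real.log (1 / AdditiveChannel.upperEnv p (f x))))
    (F : ProbabilityMeasure ℝ)
    (hF : AdditiveChannel.IsCapacityAchieving f p C A F) :
    ¬ Bornology.IsBounded (F : Measure ℝ).support := by
  intro hbdd
  obtain ⟨B, hB⟩ := (hbdd.isCompact_closure.image hf.continuous.abs).bddAbove
  have hFB : ∀ᵐ z ∂(F : Measure ℝ), |f z| ≤ max B |f 0| := by
    filter_upwards [(F : Measure ℝ).support_mem_ae] with z hz
    exact (hB ⟨z, subset_closure hz, rfl⟩).trans (le_max_left _ _)
  obtain ⟨c, hc, hhalf⟩ := hp.exists_halfLine (max B |f 0|)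
  obtain ⟨M, hM0, hM⟩ := hp.exists_bound
  obtain ⟨⟨hCF, hCFA⟩, hFcap⟩ := hF
  set I : ℝ := entropy (outputDensity f p F) - entropy p with hI
  have hlim := tendsto_log_one_div_upperEnv hf hp hC hcost
  -- The coefficient `c * A / (2 * (|I| + 1))` makes the cost term `C ‖x‖₊ / A * I` at most half of
  -- the gain `c * l`.
  obtain ⟨x, hxε, hx1, hxl, hxA, hx0⟩ := ((hcost.bound
    (show 0 < c * A / (2 * (|I| + 1)) by positivity)).and ((hcost.bound one_pos).and
    ((hlim.eventually_gt_atTop (2 / c * (|Real.log (1 + M) + entropy p| + |I|))).and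
    ((hlim.eventually_ge_atTop (2 / A)).and (hlim.eventually_ge_atTop 0))))).exists
  obtain ⟨S, hS, hcS, hSle⟩ := hhalf (f x)
  have ht := hp.upperEnv_pos (f x)
  set t := upperEnv p (f x)
  set l := Real.log (1 / t) with hl
  have htl : t = Real.exp (-l) := by
    rw [hl, one_div, Real.log_inv, neg_neg, Real.exp_log ht]
  have hCx : 0 ≤ C ‖x‖₊ := hC.map_zero ▸ hC.monotone zero_le
  rw [Real.norm_of_nonneg hCx, Real.norm_of_nonneg hx0] at hxε hx1
  set s := t * C ‖x‖₊ / A with hs'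
  have hs : 0 ≤ s := by positivity
  -- `t + s = exp (-l) * (1 + C ‖x‖₊ / A)`, where `C ‖x‖₊ ≤ l` and `exp l ≥ 1 + l ^ 2 / 2`.
  have hst : t + s ≤ 1 := by
    have h1 := Real.quadratic_le_exp_of_nonneg hx0
    have h2 : C ‖x‖₊ / A ≤ l / A := by gcongr; linarith
    have h3 : l / A ≤ l ^ 2 / 2 := by
      have := mul_le_mul_of_nonneg_left hxA hx0
      have e : l * (2 / A) = 2 * (l / A) := by ring
      nlinarith
    have h4 : t * Real.exp l = 1 := by rw [htl, ← Real.exp_add]; simp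
    have h5 : t + s = t * (1 + C ‖x‖₊ / A) := by rw [hs']; ring
    rw [h5, ← h4]
    exact mul_le_mul_of_nonneg_left (by linarith) ht.le
  set G := mixture F s t x hs ht.le hst with hG
  -- The weight `s` on the free input `0` pays for the weight `t` on the expensive input `x`.
  have hGin : G ∈ inputSet C A := by
    refine ⟨integrable_mixture F hs ht.le hst hCF, ?_⟩
    rw [hG, integral_mixture F hs ht.le hst hCF]
    have h1 := mul_le_mul_of_nonneg_left hCFA (show 0 ≤ 1 - t - s by linarith)
    have h2 : s * A = t * C ‖x‖₊ := by rw [hs']; field_simp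
    simp only [nnnorm_zero, hC.map_zero]
    nlinarith
  have hGB : ∀ᵐ z ∂(G : Measure ℝ), |f z| ≤ max (max B |f 0|) |f x| :=
    ae_mixture F hs ht.le hst (hFB.mono fun z hz => hz.trans (le_max_left _ _))
      ((hf.abs_mono 0 x (by simp)).trans (le_max_right _ _)) (le_max_right _ _)
  have hle : entropy (outputDensity f p G) - entropy p ≤ I := by
    have : mutualInfo f p G ≤ mutualInfo f p F := hFcap ▸ le_iSup₂_of_le G hGin le_rfl
    rwa [mutualInfo_eq_entropy_sub hf hp G hGB, mutualInfo_eq_entropy_sub hf hp F hFB,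
      EReal.coe_le_coe_iff] at this
  have hent := entropy_mixture_ge F hs ht.le hst hf hp (M := 1 + M) (l := l) hFB hS
    (fun y => (outputDensity_le hf hp G (ae_of_all _ fun _ => hM _)).trans (by linarith))
    (fun y hy => by
      rw [outputDensity_mixture F hs ht.le hst hf hp, ← htl]
      have h1 : outputDensity f p F y ≤ t :=
        outputDensity_le hf hp F (hFB.mono fun z hz => hSle y hy _ hz)
      have h2 : p (y - f 0) ≤ t := hSle y hy _ (le_max_right _ _)
      have h3 := mul_le_mul_of_nonneg_left h1 (show 0 ≤ 1 - t - s by linarith)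
      have h4 := mul_le_mul_of_nonneg_left h2 hs
      have h5 := mul_le_mul_of_nonneg_left (hM (y - f x)) ht.le
      nlinarith) hx0 hcS
  rw [← hG] at hent
  -- The weights `t` and `s` taken from `F` cost `(t + s) * I = t * (1 + C ‖x‖₊ / A) * I`.
  have hmain : t * (c * l - Real.log (1 + M) - entropy p) ≤ t * ((1 + C ‖x‖₊ / A) * I) := by
    have : t * ((1 + C ‖x‖₊ / A) * I) = (t + s) * I := by rw [hs']; ring
    rw [this, hI]
    rw [hI] at hle
    linarith
  have hmain := le_of_mul_le_mul_left hmain ht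
  have hcI : C ‖x‖₊ / A * I ≤ c / 2 * l := by
    have h1 : C ‖x‖₊ / A * I ≤ C ‖x‖₊ / A * (|I| + 1) := by
      gcongr; linarith [le_abs_self I]
    have h2 : C ‖x‖₊ / A * (|I| + 1) ≤
        (c * A / (2 * (|I| + 1)) * l) / A * (|I| + 1) := by gcongr
    have h3 : (c * A / (2 * (|I| + 1)) * l) / A * (|I| + 1) = c / 2 * l := by
      have : |I| + 1 ≠ 0 := by positivity
      field_simp
    linarith
  have hlarge : |Real.log (1 + M) + entropy p| + |I| < c / 2 * l := by
    have := mul_lt_mul_of_pos_left hxl (show 0 < c / 2 by positivity)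
    have e : c / 2 * (2 / c * (|Real.log (1 + M) + entropy p| + |I|)) =
        |Real.log (1 + M) + entropy p| + |I| := by field_simp
    rwa [e] at this
  linarith [le_abs_self (Real.log (1 + M) + entropy p), le_abs_self I]
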